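/- Let $(R,\mathfrak m)$ be a noetherian local commutative ring and let $\varphi\colon R\to R$ be a local ring endomorphism (so $\varphi(\mathfrak m)\subseteq\mathfrak m$). Write ${}^{\varphi}R$ for the $R$-module whose underlying additive group is that of $R$, with action $r\cdot x=\varphi(r)x$. Assume that $\varphi$ is finite, i.e. ${}^{\varphi}R$ is a finitely generated $R$-module, and that $\varphi$ is contracting, i.e. $\varphi^{i}(\mathfrak m)\subseteq\mathfrak m^{2}$ for some integer $i\ge 0$. For $R$-modules $M$ and $N$, regard $M\otimes_R{}^{\varphi}R$ as an $R$-module via $r\cdot(x\otimes s)=x\otimes sr$, and $\operatorname{Hom}_R({}^{\varphi}R,N)$ as an $R$-module via $(r\cdot f)(s)=f(sr)$. Let $M$ be a noetherian $R$-module and $N$ an artinian $R$-module. Then: (a) $M$ is free if and only if $M$ is isomorphic to a direct summand of the $R$-module $M\otimes_R{}^{\varphi}R$; (b) $N$ is injective if and only if $N$ is isomorphic to a direct summand of the $R$-module $\operatorname{Hom}_R({}^{\varphi}R,N)$. -/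

import Mathlib

universe u v w

/-- An endomorphism `φ` of a local ring `(R, 𝔪)` is contracting if it is local and
`φ ^ i (𝔪) ⊆ 𝔪 ^ 2` for some natural number `i`. (The value `i = 0` adds nothing: `𝔪 ⊆ 𝔪 ^ 2`
implies that `i = 1` works as well, since `φ` is local.) -/
def IsContracting {R : Type u} [CommRing R] [IsLocalRing R] (φ : R →+* R) : Prop :=
  IsLocalHom φ ∧ ∃ i : ℕ, ∀ x ∈ IsLocalRing.maximalIdeal R,
    (⇑φ)^[i] x ∈ IsLocalRing.maximalIdeal R ^ 2

/-- `M` is (isomorphic to) a direct summand of the `R`-module `P`. -/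
def IsDirectSummand (R : Type u) [CommRing R] (M : Type v) (P : Type w)
    [AddCommGroup M] [Module R M] [AddCommGroup P] [Module R P] : Prop :=
  ∃ p q : Submodule R P, IsCompl p q ∧ Nonempty (M ≃ₗ[R] p)

section Twist

variable {R : Type u} [CommRing R] (φ : R →+* R)

/-- The module `ᵠR`: the additive group of `R`, with `r • x = φ r * x`. -/
def Twist (_φ : R →+* R) : Type u := R

namespace Twist

instance : AddCommGroup (Twist φ) := inferInstanceAs (AddCommGroup R)

instance : Module R (Twist φ) := Module.compHom R φ

/-- The identity map from `R` to `ᵠR`. -/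
def of : R ≃+ Twist φ := AddEquiv.refl R

theorem smul_of (r x : R) : r • of φ x = of φ (φ r * x) := rfl

/-- Multiplication by `r` in the ring `R`, as an `R`-linear map from `ᵠR` to itself:
`s ↦ s * r`. -/
def mulRight (r : R) : Twist φ →ₗ[R] Twist φ where
  toFun s := of φ ((of φ).symm s * r)
  map_add' s t := add_mul (R := R) s t r
  map_smul' a s := mul_assoc (G := R) (φ a) s r

theorem mulRight_of (r s : R) : mulRight φ r (of φ s) = of φ (s * r) := rfl

theorem mulRight_one : mulRight φ 1 = LinearMap.id :=
  LinearMap.ext fun s => mul_one (M := R) s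

theorem mulRight_zero : mulRight φ 0 = 0 :=
  LinearMap.ext fun s => mul_zero (M₀ := R) s

theorem mulRight_add (a b : R) : mulRight φ (a + b) = mulRight φ a + mulRight φ b :=
  LinearMap.ext fun s => mul_add (R := R) s a b

theorem mulRight_mul (a b : R) : mulRight φ (a * b) = mulRight φ a ∘ₗ mulRight φ b :=
  LinearMap.ext fun s => show (id s : R) * (a * b) = (id s : R) * b * a by ring

end Twist

/-- The additive group `M ⊗_R ᵠR`, to be given the `R`-module structure
`r • (x ⊗ s) = x ⊗ (s * r)`. -/
def TensorTwist (M : Type v) [AddCommGroup M] [Module R M] : Type (max u v) :=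
  TensorProduct R M (Twist φ)

namespace TensorTwist

variable (M : Type v) [AddCommGroup M] [Module R M]

noncomputable instance : AddCommGroup (TensorTwist φ M) :=
  inferInstanceAs (AddCommGroup (TensorProduct R M (Twist φ)))

/-- The elementary tensor `x ⊗ s`. -/
noncomputable def tmul (x : M) (s : R) : TensorTwist φ M :=
  TensorProduct.tmul R x (Twist.of φ s)

/-- `R` acts on `M ⊗_R ᵠR` through multiplication on the second factor. -/
noncomputable instance : Module R (TensorTwist φ M) where
  smul r t := LinearMap.lTensor M (Twist.mulRight φ r) t
  one_smul t := show LinearMap.lTensor M (Twist.mulRight φ 1) t = t by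
    rw [Twist.mulRight_one, LinearMap.lTensor_id]; rfl
  mul_smul a b t := show LinearMap.lTensor M (Twist.mulRight φ (a * b)) t =
      LinearMap.lTensor M (Twist.mulRight φ a) (LinearMap.lTensor M (Twist.mulRight φ b) t) by
    rw [Twist.mulRight_mul, LinearMap.lTensor_comp]; rfl
  smul_zero a := map_zero (LinearMap.lTensor M (Twist.mulRight φ a))
  smul_add a s t := map_add (LinearMap.lTensor M (Twist.mulRight φ a)) s t
  add_smul a b t := show LinearMap.lTensor M (Twist.mulRight φ (a + b)) t =
      LinearMap.lTensor M (Twist.mulRight φ a) t + LinearMap.lTensor M (Twist.mulRight φ b) t by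
    rw [Twist.mulRight_add, LinearMap.lTensor_add]; rfl
  zero_smul t := show LinearMap.lTensor M (Twist.mulRight φ 0) t = 0 by
    rw [Twist.mulRight_zero, LinearMap.lTensor_zero]; rfl

theorem smul_tmul (r : R) (x : M) (s : R) : r • tmul φ M x s = tmul φ M x (s * r) := rfl

end TensorTwist

/-- The additive group `Hom_R(ᵠR, N)`, to be given the `R`-module structure
`(r • f) s = f (s * r)`. -/
def HomTwist (N : Type v) [AddCommGroup N] [Module R N] : Type (max u v) :=
  Twist φ →ₗ[R] N

namespace HomTwist

variable (N : Type v) [AddCommGroup N] [Module R N]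

instance : AddCommGroup (HomTwist φ N) :=
  inferInstanceAs (AddCommGroup (Twist φ →ₗ[R] N))

/-- An element of `Hom_R(ᵠR, N)` as a linear map. -/
def toHom (f : HomTwist φ N) : Twist φ →ₗ[R] N := f

/-- The value of `f ∈ Hom_R(ᵠR, N)` at `s`. -/
def eval (f : HomTwist φ N) (s : R) : N := toHom φ N f (Twist.of φ s)

/-- `R` acts on `Hom_R(ᵠR, N)` through multiplication on the argument. -/
instance : Module R (HomTwist φ N) where
  smul r f := LinearMap.comp (toHom φ N f) (Twist.mulRight φ r)
  one_smul f := show LinearMap.comp (toHom φ N f) (Twist.mulRight φ 1) = f by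
    rw [Twist.mulRight_one]; rfl
  mul_smul a b f := show LinearMap.comp (toHom φ N f) (Twist.mulRight φ (a * b)) =
      LinearMap.comp (LinearMap.comp (toHom φ N f) (Twist.mulRight φ b)) (Twist.mulRight φ a) by
    rw [mul_comm, Twist.mulRight_mul]; rfl
  smul_zero a := LinearMap.zero_comp (Twist.mulRight φ a)
  smul_add a f g := LinearMap.add_comp (Twist.mulRight φ a) (toHom φ N g) (toHom φ N f)
  add_smul a b f := show LinearMap.comp (toHom φ N f) (Twist.mulRight φ (a + b)) =
      LinearMap.comp (toHom φ N f) (Twist.mulRight φ a) +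
        LinearMap.comp (toHom φ N f) (Twist.mulRight φ b) by
    rw [Twist.mulRight_add, LinearMap.comp_add]
  zero_smul f := show LinearMap.comp (toHom φ N f) (Twist.mulRight φ 0) = 0 by
    rw [Twist.mulRight_zero, LinearMap.comp_zero]

theorem smul_eval (r : R) (f : HomTwist φ N) (s : R) :
    eval φ N (r • f) s = eval φ N f (s * r) := rfl

end HomTwist

end Twist

/-! For the "if" directions, test `M` only against surjections of modules killed by an ideal `J`.
Modulo the maximal ideal `𝔪` everything is semisimple, so every `M` passes for `J = 𝔪`. If `M`
passes for `J`, then by adjunction `M ⊗ ᵠR` passes for `φ(J)R`, and so does its summand `M`. As `φ`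
is contracting, iteration reaches every `𝔪 ^ k`. For finitely generated `M` a Nakayama argument and
Krull's intersection theorem then give freeness; dually, Artin–Rees gives Baer's criterion for
artinian `N`.

Conversely, a basis splits a free `M` off its twist, and an injective `N` embeds in `Hom(ᵠR, N)` by
a map built on its socle. -/

open IsLocalRing

section Summand

variable {R : Type u} [CommRing R]

theorem isDirectSummand_iff_exists_retraction {M : Type v} {P : Type w}
    [AddCommGroup M] [Module R M] [AddCommGroup P] [Module R P] :
    IsDirectSummand R M P ↔
      ∃ (i : M →ₗ[R] P) (p : P →ₗ[R] M), ∀ x, p (i x) = x := by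
  constructor
  · rintro ⟨p, q, hpq, ⟨e⟩⟩
    refine ⟨p.subtype ∘ₗ e.toLinearMap, e.symm.toLinearMap ∘ₗ p.projectionOnto q hpq,
      fun x => ?_⟩
    simp
  · rintro ⟨i, p, h⟩
    refine ⟨LinearMap.range i, LinearMap.ker p, ?_,
      ⟨LinearEquiv.ofInjective i (Function.LeftInverse.injective h)⟩⟩
    rw [isCompl_iff, Submodule.disjoint_def, codisjoint_iff, eq_top_iff]
    refine ⟨?_, fun y _ => ?_⟩
    · rintro _ ⟨x, rfl⟩ hx
      rw [LinearMap.mem_ker, h] at hx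
      rw [hx, map_zero]
    · rw [← add_sub_cancel (i (p y)) y]
      exact Submodule.add_mem_sup ⟨_, rfl⟩ (by simp [h])

end Summand

/-! ### Restriction of scalars along `φ` and its two adjoints. -/

section Restrict

variable {R : Type u} [CommRing R] (φ : R →+* R)

/-- The restriction of scalars of a module along `φ`: the same additive group, on which `r` acts
as `φ r`. -/
def Restrict (_φ : R →+* R) (B : Type v) : Type v := B

namespace Restrict

variable (B : Type v) [AddCommGroup B] [Module R B]

instance : AddCommGroup (Restrict φ B) := inferInstanceAs (AddCommGroup B)

instance : Module R (Restrict φ B) := Module.compHom B φ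

/-- The identity map from a module to its restriction of scalars. -/
def of : B ≃+ Restrict φ B := AddEquiv.refl B

variable {B}

theorem smul_of (r : R) (x : B) : r • of φ B x = of φ B (φ r • x) := rfl

/-- A linear map, regarded as a map between the restrictions of scalars. -/
def map {C : Type w} [AddCommGroup C] [Module R C] (f : B →ₗ[R] C) :
    Restrict φ B →ₗ[R] Restrict φ C where
  toFun x := of φ C (f ((of φ B).symm x))
  map_add' _ _ := f.map_add _ _
  map_smul' r _ := f.map_smul (φ r) _

theorem map_of {C : Type w} [AddCommGroup C] [Module R C] (f : B →ₗ[R] C) (x : B) :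
    map φ f (of φ B x) = of φ C (f x) := rfl

end Restrict

namespace TensorTwist

variable {M : Type v} [AddCommGroup M] [Module R M] {C : Type w} [AddCommGroup C] [Module R C]

theorem induction_tmul {P : TensorTwist φ M → Prop} (t : TensorTwist φ M) (h0 : P 0)
    (hadd : ∀ s t, P s → P t → P (s + t)) (h : ∀ x s, P (tmul φ M x s)) : P t :=
  TensorProduct.induction_on (motive := P) t h0 h hadd

/-- The map `x ⊗ s ↦ s • g x` induced by a linear map `g` into a restriction of scalars. -/
noncomputable def lift (g : M →ₗ[R] Restrict φ C) : TensorTwist φ M →ₗ[R] C :=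
  let h : TensorProduct R M (Twist φ) →ₗ[R] Restrict φ C :=
    TensorProduct.lift <| LinearMap.mk₂ R
      (fun x s => Restrict.of φ C
        ((Twist.of φ).symm s • (Restrict.of φ C).symm (g x)))
      (fun x y s => by rw [map_add, map_add, smul_add, map_add])
      (fun r x s => by
        rw [g.map_smul, Restrict.smul_of]
        exact congrArg _ (smul_comm ((Twist.of φ).symm s) (φ r) _))
      (fun x s t => by rw [map_add, add_smul, map_add])
      (fun r x s => by
        rw [Restrict.smul_of, smul_smul]
        rfl)
  have hadd : ∀ s t : TensorTwist φ M, (Restrict.of φ C).symm (h (s + t)) =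
      (Restrict.of φ C).symm (h s) + (Restrict.of φ C).symm (h t) :=
    fun s t => (congrArg _ (h.map_add s t)).trans (map_add _ _ _)
  { toFun := fun t => (Restrict.of φ C).symm (h t)
    map_add' := hadd
    map_smul' := fun r t => by
      induction t using induction_tmul with
      | h0 =>
        rw [smul_zero]
        exact (smul_zero (M := R) (A := C) r).symm
      | hadd s t hs ht =>
        rw [smul_add]
        exact (hadd _ _).trans ((congrArg₂ (· + ·) hs ht).trans
          ((smul_add (M := R) (A := C) r _ _).symm.trans (congrArg (r • ·) (hadd s t).symm)))
      | h x s =>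
        change (s * r) • (Restrict.of φ C).symm (g x) = r • s • (Restrict.of φ C).symm (g x)
        rw [mul_comm, mul_smul] }

theorem lift_tmul (g : M →ₗ[R] Restrict φ C) (x : M) (s : R) :
    lift φ g (tmul φ M x s) = s • (Restrict.of φ C).symm (g x) := rfl

theorem hom_ext {f g : TensorTwist φ M →ₗ[R] C}
    (h : ∀ x, f (tmul φ M x 1) = g (tmul φ M x 1)) : f = g := by
  ext t
  induction t using induction_tmul with
  | h0 => simp
  | hadd s t hs ht => simp [hs, ht]
  | h x s => rw [← one_mul s, ← smul_tmul, map_smul, map_smul, h]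

/-- The map `x ↦ x ⊗ 1`. -/
noncomputable def unit (M : Type v) [AddCommGroup M] [Module R M] :
    M →ₗ[R] Restrict φ (TensorTwist φ M) where
  toFun x := Restrict.of φ _ (tmul φ M x 1)
  map_add' x y := TensorProduct.add_tmul x y _
  map_smul' r x := by
    rw [RingHom.id_apply, Restrict.smul_of, smul_tmul, one_mul]
    refine congrArg (Restrict.of φ _) ((TensorProduct.smul_tmul r x (Twist.of φ (1 : R))).trans ?_)
    rw [Twist.smul_of, mul_one]
    rfl

end TensorTwist

namespace HomTwist

variable {N : Type v} [AddCommGroup N] [Module R N] {B : Type w} [AddCommGroup B] [Module R B]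

variable {φ} in
@[ext]
theorem ext {f g : HomTwist φ N} (h : ∀ s, eval φ N f s = eval φ N g s) : f = g :=
  LinearMap.ext (f := toHom φ N f) (g := toHom φ N g) h

/-- The map `b ↦ (s ↦ g (s • b))` induced by a linear map `g` out of a restriction of scalars. -/
def curry (g : Restrict φ B →ₗ[R] N) : B →ₗ[R] HomTwist φ N where
  toFun b := show Twist φ →ₗ[R] N from
    { toFun := fun s => g (Restrict.of φ B ((Twist.of φ).symm s • b))
      map_add' := fun s t => by rw [map_add, add_smul, map_add, map_add]
      map_smul' := fun r s => by
        rw [RingHom.id_apply, ← map_smul, Restrict.smul_of, smul_smul]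
        rfl }
  map_add' b c := ext fun s => by
    change g (Restrict.of φ B (s • (b + c))) =
      g (Restrict.of φ B (s • b)) + g (Restrict.of φ B (s • c))
    rw [smul_add, map_add, map_add]
  map_smul' r b := ext fun s => by
    change g (Restrict.of φ B (s • r • b)) = g (Restrict.of φ B ((s * r) • b))
    rw [smul_smul]

theorem eval_curry (g : Restrict φ B →ₗ[R] N) (b : B) (s : R) :
    eval φ N (curry φ g b) s = g (Restrict.of φ B (s • b)) := rfl

/-- Evaluation at `1`. -/
def counit (N : Type v) [AddCommGroup N] [Module R N] : Restrict φ (HomTwist φ N) →ₗ[R] N where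
  toFun f := eval φ N ((Restrict.of φ _).symm f) 1
  map_add' _ _ := rfl
  map_smul' r f := by
    rw [RingHom.id_apply]
    refine Eq.trans ?_ ((toHom φ N ((Restrict.of φ _).symm f)).map_smul r (Twist.of φ (1 : R)))
    rw [Twist.smul_of, mul_comm]
    rfl

theorem counit_of (f : HomTwist φ N) : counit φ N (Restrict.of φ _ f) = eval φ N f 1 := rfl

end HomTwist

end Restrict

/-! ### Projectivity and injectivity relative to an ideal. -/

section Relative

variable {R : Type u} [CommRing R]

/-- `M` has the lifting property of projective modules with respect to surjections between modules
annihilated by the ideal `J`. -/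
def ProjectiveModulo (M : Type v) [AddCommGroup M] [Module R M] (J : Ideal R) : Prop :=
  ∀ (B C : Type u) [AddCommGroup B] [AddCommGroup C] [Module R B] [Module R C],
    (∀ r ∈ J, ∀ b : B, r • b = 0) → ∀ p : B →ₗ[R] C, Function.Surjective p →
      ∀ f : M →ₗ[R] C, ∃ g : M →ₗ[R] B, p ∘ₗ g = f

/-- `N` has the extension property of injective modules with respect to injections between modules
annihilated by the ideal `J`. -/
def InjectiveModulo (N : Type v) [AddCommGroup N] [Module R N] (J : Ideal R) : Prop :=
  ∀ (A B : Type u) [AddCommGroup A] [AddCommGroup B] [Module R A] [Module R B],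
    (∀ r ∈ J, ∀ b : B, r • b = 0) → ∀ i : A →ₗ[R] B, Function.Injective i →
      ∀ f : A →ₗ[R] N, ∃ g : B →ₗ[R] N, g ∘ₗ i = f

section Monotone

variable {M : Type v} [AddCommGroup M] [Module R M] {I J : Ideal R}

theorem ProjectiveModulo.mono (h : ProjectiveModulo M I) (hIJ : I ≤ J) : ProjectiveModulo M J :=
  fun B C _ _ _ _ hB => h B C fun r hr => hB r (hIJ hr)

theorem InjectiveModulo.mono (h : InjectiveModulo M I) (hIJ : I ≤ J) : InjectiveModulo M J :=
  fun A B _ _ _ _ hB => h A B fun r hr => hB r (hIJ hr)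

end Monotone

section Retract

variable {M : Type v} {P : Type w} [AddCommGroup M] [Module R M] [AddCommGroup P] [Module R P]
  {J : Ideal R}

theorem ProjectiveModulo.of_isDirectSummand (hP : ProjectiveModulo P J)
    (h : IsDirectSummand R M P) : ProjectiveModulo M J := by
  obtain ⟨i, q, hqi⟩ := isDirectSummand_iff_exists_retraction.1 h
  intro B C _ _ _ _ hB p hp f
  obtain ⟨g, hg⟩ := hP B C hB p hp (f ∘ₗ q)
  refine ⟨g ∘ₗ i, ?_⟩
  rw [← LinearMap.comp_assoc, hg]
  ext x
  simp [hqi]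

theorem InjectiveModulo.of_isDirectSummand (hP : InjectiveModulo P J)
    (h : IsDirectSummand R M P) : InjectiveModulo M J := by
  obtain ⟨i, q, hqi⟩ := isDirectSummand_iff_exists_retraction.1 h
  intro A B _ _ _ _ hB j hj f
  obtain ⟨g, hg⟩ := hP A B hB j hj (i ∘ₗ f)
  refine ⟨q ∘ₗ g, ?_⟩
  rw [LinearMap.comp_assoc, hg]
  ext x
  simp [hqi]

end Retract

section Twist

variable (φ : R →+* R) {M : Type v} [AddCommGroup M] [Module R M] {J : Ideal R}

/-- Extension of scalars is left adjoint to restriction, and restricting along `φ` turns modules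
killed by `φ(J)R` into modules killed by `J`. -/
theorem ProjectiveModulo.tensorTwist (h : ProjectiveModulo M J) :
    ProjectiveModulo (TensorTwist φ M) (J.map φ) := by
  intro B C _ _ _ _ hB p hp f
  obtain ⟨g, hg⟩ := h (Restrict φ B) (Restrict φ C)
    (fun r hr b => hB _ (Ideal.mem_map_of_mem φ hr) ((Restrict.of φ B).symm b))
    (Restrict.map φ p) hp (Restrict.map φ f ∘ₗ TensorTwist.unit φ M)
  refine ⟨TensorTwist.lift φ g, TensorTwist.hom_ext φ fun x => ?_⟩
  rw [LinearMap.comp_apply, TensorTwist.lift_tmul, one_smul]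
  exact LinearMap.congr_fun hg x

theorem InjectiveModulo.homTwist (h : InjectiveModulo M J) :
    InjectiveModulo (HomTwist φ M) (J.map φ) := by
  intro A B _ _ _ _ hB i hi f
  obtain ⟨g, hg⟩ := h (Restrict φ A) (Restrict φ B)
    (fun r hr b => hB _ (Ideal.mem_map_of_mem φ hr) ((Restrict.of φ B).symm b))
    (Restrict.map φ i) hi (HomTwist.counit φ M ∘ₗ Restrict.map φ f)
  refine ⟨HomTwist.curry φ g, LinearMap.ext fun a => HomTwist.ext fun s => ?_⟩
  rw [LinearMap.comp_apply, HomTwist.eval_curry, ← map_smul]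
  refine (LinearMap.congr_fun hg (Restrict.of φ A (s • a))).trans ?_
  rw [LinearMap.comp_apply, Restrict.map_of, HomTwist.counit_of, map_smul, HomTwist.smul_eval,
    one_mul]

end Twist

end Relative

/-! ### From powers of the maximal ideal to freeness and Baer's criterion. -/

section Local

variable {R : Type u} [CommRing R] [IsLocalRing R]

theorem isSemisimpleModule_of_maximalIdeal_smul_eq_zero {B : Type v} [AddCommGroup B] [Module R B]
    (hB : ∀ r ∈ maximalIdeal R, ∀ b : B, r • b = 0) : IsSemisimpleModule R B := by
  have hB' : Module.IsTorsionBySet R B (maximalIdeal R) := fun b r => hB r r.2 b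
  let := hB'.module
  let := Ideal.Quotient.field (maximalIdeal R)
  exact hB'.isSemisimpleModule_iff.1 inferInstance

theorem projectiveModulo_maximalIdeal (M : Type v) [AddCommGroup M] [Module R M] :
    ProjectiveModulo M (maximalIdeal R) := fun B C _ _ _ _ hB p hp f => by
  have := isSemisimpleModule_of_maximalIdeal_smul_eq_zero hB
  exact IsSemisimpleModule.lifting_property p hp f

theorem injectiveModulo_maximalIdeal (N : Type v) [AddCommGroup N] [Module R N] :
    InjectiveModulo N (maximalIdeal R) := fun A B _ _ _ _ hB i hi f => by
  have := isSemisimpleModule_of_maximalIdeal_smul_eq_zero hB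
  exact IsSemisimpleModule.extension_property i hi f

/-- A property of ideals that passes to larger ideals and to extensions along a contracting
endomorphism holds for all powers of the maximal ideal as soon as it holds for the maximal
ideal. -/
theorem IsContracting.pow_maximalIdeal_induction {φ : R →+* R} (hφ : IsContracting φ)
    {P : Ideal R → Prop} (hmono : ∀ I J, I ≤ J → P I → P J) (hmap : ∀ J, P J → P (J.map φ))
    (h : P (maximalIdeal R)) (k : ℕ) : P (maximalIdeal R ^ k) := by
  obtain ⟨-, i, hi⟩ := hφ
  have hle : (maximalIdeal R).map (φ ^ i) ≤ maximalIdeal R ^ 2 :=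
    Ideal.map_le_iff_le_comap.2 fun x hx => by
      rw [Ideal.mem_comap, RingHom.coe_pow]
      exact hi x hx
  have hiter : ∀ j J, P J → P (J.map (φ ^ j)) := by
    intro j
    induction j with
    | zero => intro J hJ; rwa [pow_zero, RingHom.one_def, Ideal.map_id]
    | succ j ih =>
      intro J hJ
      rw [pow_succ, RingHom.mul_def, ← Ideal.map_map]
      exact ih _ (hmap J hJ)
  have hpos : ∀ k, P (maximalIdeal R ^ (k + 1)) := by
    intro k
    induction k with
    | zero => rwa [zero_add, pow_one]
    | succ k ih =>
      -- `φ ^ i` doubles the exponent, and `2 * (k + 1) ≥ k + 2`; from exponent `0` doubling would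
      -- gain nothing.
      refine hmono _ _ ?_ (hiter i _ ih)
      rw [Ideal.map_pow]
      refine (Ideal.pow_right_mono hle _).trans ?_
      rw [← pow_mul]
      exact Ideal.pow_le_pow_right (by omega)
  exact hmono _ _ (Ideal.pow_le_pow_right k.le_succ) (hpos k)

/-- Lift a basis of `M / 𝔪M`: the lifts generate by Nakayama, and independence over the residue
field forces the coefficients of every relation into `𝔪`. -/
theorem exists_pi_surjective_ker_le_maximalIdeal (M : Type v) [AddCommGroup M] [Module R M]
    [Module.Finite R M] : ∃ (n : ℕ) (p : (Fin n → R) →ₗ[R] M), Function.Surjective p ∧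
      ∀ a, p a = 0 → ∀ j, a j ∈ maximalIdeal R := by
  let b := Module.finBasis (ResidueField R) (TensorProduct R (ResidueField R) M)
  have hsurj := TensorProduct.mk_surjective R M (ResidueField R) Ideal.Quotient.mk_surjective
  choose x hx using fun j => hsurj (b j)
  refine ⟨_, Fintype.linearCombination R x, ?_, fun a ha j => ?_⟩
  · rw [← LinearMap.range_eq_top, Fintype.range_linearCombination]
    exact span_eq_top_of_tmul_eq_basis x b hx
  · rw [← residue_eq_zero_iff]
    have := congrArg (TensorProduct.mk R (ResidueField R) M 1) ha
    rw [Fintype.linearCombination_apply, map_sum, map_zero] at this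
    refine Fintype.linearIndependent_iff.1 b.linearIndependent (fun j => residue R (a j)) ?_ j
    rw [← this]
    refine Finset.sum_congr rfl fun j _ => ?_
    rw [map_smul, hx, ← ResidueField.algebraMap_eq, algebraMap_smul]

/-- Over a noetherian local ring, a finitely generated module is free if it is relatively
projective modulo all powers of the maximal ideal. -/
theorem free_of_projectiveModulo_pow [IsNoetherianRing R] (M : Type v) [AddCommGroup M]
    [Module R M] [Module.Finite R M] (h : ∀ k, ProjectiveModulo M (maximalIdeal R ^ k)) :
    Module.Free R M := by
  obtain ⟨n, p, hp, hker⟩ := exists_pi_surjective_ker_le_maximalIdeal (R := R) M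
  suffices hinj : LinearMap.ker p = ⊥ from
    Module.Free.of_equiv (LinearEquiv.ofBijective p ⟨LinearMap.ker_eq_bot.1 hinj, hp⟩)
  rw [eq_bot_iff, ← Ideal.iInf_pow_smul_eq_bot_of_isLocalRing (maximalIdeal R)
    (Ideal.IsPrime.ne_top inferInstance), le_iInf_iff]
  intro k
  have hker' : LinearMap.ker p ≤ maximalIdeal R • (⊤ : Submodule R (Fin n → R)) := by
    intro a ha
    rw [← Finset.univ_sum_single a]
    refine Submodule.sum_mem _ fun j _ => ?_
    rw [← mul_one (a j), ← smul_eq_mul, Pi.single_smul]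
    exact Submodule.smul_mem_smul (hker a ha j) trivial
  let D : Submodule R (Fin n → R) := maximalIdeal R ^ k • ⊤
  let K : Submodule R ((Fin n → R) ⧸ D) := (LinearMap.ker p).map D.mkQ
  let e := p.quotKerEquivOfSurjective hp
  -- With `F` the free cover, `f` is the natural map from `M = F / ker p` to `F / (ker p + 𝔪 ^ k
  -- F)`. It is lifted to `F / 𝔪 ^ k F`.
  let f : M →ₗ[R] (((Fin n → R) ⧸ D) ⧸ K) :=
    (Submodule.mapQ (LinearMap.ker p) K D.mkQ (Submodule.le_comap_map _ _)) ∘ₗ e.symm.toLinearMap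
  have hf : ∀ a, f (p a) = K.mkQ (D.mkQ a) := fun a => by
    have : e.symm (p a) = (LinearMap.ker p).mkQ a := by
      rw [LinearEquiv.symm_apply_eq]; rfl
    simp only [f, LinearMap.comp_apply, LinearEquiv.coe_coe, this]
    rfl
  obtain ⟨g, hg⟩ := h k _ _ (fun r hr b => by
    obtain ⟨b, rfl⟩ := D.mkQ_surjective b
    rw [← map_smul, Submodule.mkQ_apply, Submodule.Quotient.mk_eq_zero]
    exact Submodule.smul_mem_smul hr trivial) K.mkQ K.mkQ_surjective f
  have hgp : ∀ a ∈ D, g (p a) = 0 := by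
    intro a ha
    refine Submodule.smul_induction_on ha (fun r hr a _ => ?_) fun a b ha hb => ?_
    · rw [map_smul, map_smul]
      obtain ⟨b, hb⟩ := D.mkQ_surjective (g (p a))
      rw [← hb, ← map_smul, Submodule.mkQ_apply, Submodule.Quotient.mk_eq_zero]
      exact Submodule.smul_mem_smul hr trivial
    · rw [map_add, map_add, ha, hb, add_zero]
  -- `t` is the identity modulo `K`, which lies in `𝔪 (F / D)`, so it is surjective by Nakayama and
  -- hence injective. It kills the image of `ker p`, so `ker p ≤ D`.
  let t : ((Fin n → R) ⧸ D) →ₗ[R] ((Fin n → R) ⧸ D) := D.liftQ (g ∘ₗ p) hgp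
  have ht : Function.Surjective t := by
    rw [← LinearMap.range_eq_top, ← top_le_iff]
    refine Submodule.le_of_le_smul_of_le_jacobson_bot (I := maximalIdeal R) Module.Finite.fg_top
      (maximalIdeal_le_jacobson _) fun y _ => ?_
    obtain ⟨a, rfl⟩ := D.mkQ_surjective y
    have hK : D.mkQ a - g (p a) ∈ K := by
      rw [← Submodule.Quotient.mk_eq_zero, ← Submodule.mkQ_apply, map_sub, ← hf]
      exact sub_eq_zero.2 (LinearMap.congr_fun hg (p a)).symm
    rw [← add_sub_cancel (g (p a)) (D.mkQ a)]
    refine Submodule.add_mem_sup ⟨D.mkQ a, rfl⟩ ?_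
    have := Submodule.map_mono (f := D.mkQ) hker' hK
    rw [Submodule.map_smul''] at this
    exact Submodule.smul_mono le_rfl le_top this
  have htinj := OrzechProperty.injective_of_surjective_endomorphism t ht
  intro a ha
  rw [← Submodule.Quotient.mk_eq_zero]
  apply htinj
  rw [map_zero]
  change g (p a) = 0
  rw [LinearMap.mem_ker.1 ha, map_zero]

/-- The descending chain `𝔪 ^ k • A` stabilizes, and Nakayama makes its stable value zero. -/
theorem exists_pow_maximalIdeal_smul_eq_bot [IsNoetherianRing R] {N : Type v} [AddCommGroup N]
    [Module R N] [IsArtinian R N] (A : Submodule R N) (hA : A.FG) :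
    ∃ k, maximalIdeal R ^ k • A = ⊥ := by
  obtain ⟨k, hk⟩ := IsArtinian.monotone_stabilizes
    (⟨fun k => OrderDual.toDual (maximalIdeal R ^ k • A), fun i j hij =>
      Submodule.smul_mono_left (Ideal.pow_le_pow_right hij)⟩ : ℕ →o (Submodule R N)ᵒᵈ)
  refine ⟨k, ?_⟩
  refine Submodule.eq_bot_of_le_smul_of_le_jacobson_bot (maximalIdeal R) _
    (Submodule.FG.smul (IsNoetherian.noetherian _) hA) ?_ (maximalIdeal_le_jacobson _)
  have := hk (k + 1) k.le_succ
  rw [← Submodule.mul_smul, ← pow_succ']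
  exact le_of_eq (congrArg OrderDual.ofDual this)

/-- Over a noetherian local ring, an artinian module satisfies Baer's criterion if it is relatively
injective modulo all powers of the maximal ideal. -/
theorem baer_of_injectiveModulo_pow [IsNoetherianRing R] (N : Type v) [AddCommGroup N]
    [Module R N] [IsArtinian R N] (h : ∀ k, InjectiveModulo N (maximalIdeal R ^ k)) :
    Module.Baer R N := by
  intro I f
  obtain ⟨k, hk⟩ := exists_pow_maximalIdeal_smul_eq_bot (R := R) (LinearMap.range f)
    (by rw [LinearMap.range_eq_map]; exact (Module.Finite.fg_top).map f)
  -- By Artin–Rees, `f` vanishes on `I ∩ 𝔪 ^ (c + k)`, so it factors through a submodule of `R ⧸ 𝔪 ^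
  -- (c + k)`, where relative injectivity applies.
  obtain ⟨c, hc⟩ := (maximalIdeal R).exists_pow_inf_eq_pow_smul I
  have hle : maximalIdeal R ^ (c + k) ⊓ I ≤ maximalIdeal R ^ k • I := by
    have := hc (c + k) (Nat.le_add_right c k)
    rw [smul_eq_mul, Ideal.mul_top, Nat.add_sub_cancel_left] at this
    rw [this]
    exact Submodule.smul_mono le_rfl inf_le_right
  have hf : ∀ x : I, (x : R) ∈ maximalIdeal R ^ (c + k) → f x = 0 := by
    intro x hx
    have hx' : (x : R) ∈ (maximalIdeal R ^ k • (⊤ : Submodule R I)).map I.subtype := by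
      rw [Submodule.map_smul'', Submodule.map_top, Submodule.range_subtype]
      exact hle ⟨hx, x.2⟩
    obtain ⟨y, hy, hyx⟩ := hx'
    obtain rfl : y = x := Subtype.ext hyx
    have := Submodule.mem_map_of_mem (f := f) hy
    rwa [Submodule.map_smul'', Submodule.map_top, hk] at this
  let J : Ideal R := maximalIdeal R ^ (c + k)
  let q : I →ₗ[R] R ⧸ J := J.mkQ ∘ₗ I.subtype
  have hq : LinearMap.ker q ≤ LinearMap.ker f := fun x hx =>
    hf x ((Submodule.Quotient.mk_eq_zero J).1 hx)
  obtain ⟨g, hg⟩ := h (c + k) (I ⧸ LinearMap.ker q) (R ⧸ J) (fun r hr b => by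
    obtain ⟨b, rfl⟩ := J.mkQ_surjective b
    rw [← map_smul, Submodule.mkQ_apply, Submodule.Quotient.mk_eq_zero]
    exact J.mul_mem_right b hr) ((LinearMap.ker q).liftQ q le_rfl)
    (LinearMap.ker_eq_bot.1 (Submodule.ker_liftQ_eq_bot _ _ _ le_rfl)) ((LinearMap.ker q).liftQ f hq)
  exact ⟨g ∘ₗ J.mkQ, fun x hx => LinearMap.congr_fun hg (Submodule.Quotient.mk ⟨x, hx⟩)⟩

end Local

/-! ### Free modules split off their twist. -/

section Free

variable {R : Type u} [CommRing R] (φ : R →+* R)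

theorem Module.Free.isDirectSummand_tensorTwist (M : Type v) [AddCommGroup M] [Module R M]
    [Module.Free R M] : IsDirectSummand R M (TensorTwist φ M) := by
  let b := Module.Free.chooseBasis R M
  refine isDirectSummand_iff_exists_retraction.2 ⟨b.constr ℕ fun j => TensorTwist.tmul φ M (b j) 1,
    TensorTwist.lift φ (b.constr ℕ fun j => Restrict.of φ M (b j)), fun x => ?_⟩
  rw [← LinearMap.comp_apply]
  refine LinearMap.congr_fun (g := LinearMap.id) (b.ext fun j => ?_) x
  rw [LinearMap.comp_apply, b.constr_basis, TensorTwist.lift_tmul, b.constr_basis, one_smul]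
  rfl

end Free

/-! ### Injective artinian modules split off their twist. -/

section Injective

variable {R : Type u} [CommRing R] [IsLocalRing R]

/-- Every nonzero submodule of an artinian module over a noetherian local ring contains a nonzero
element annihilated by the maximal ideal. -/
theorem exists_ne_zero_mem_torsionBySet_maximalIdeal [IsNoetherianRing R] {N : Type v}
    [AddCommGroup N] [Module R N] [IsArtinian R N] {A : Submodule R N} (hA : A ≠ ⊥) :
    ∃ x ∈ A, x ≠ 0 ∧ x ∈ Submodule.torsionBySet R N (maximalIdeal R) := by
  classical
  obtain ⟨y, hyA, hy⟩ := A.ne_bot_iff.1 hA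
  -- The last nonzero `𝔪 ^ k • (R y)` is killed by `𝔪`.
  have hex := exists_pow_maximalIdeal_smul_eq_bot (R := R) _ (Submodule.fg_span_singleton y)
  have hspec := Nat.find_spec hex
  have hpos : Nat.find hex ≠ 0 := fun h0 => by
    rw [h0, pow_zero, Ideal.one_eq_top, Submodule.top_smul, Submodule.span_singleton_eq_bot] at hspec
    exact hy hspec
  obtain ⟨k, hk⟩ := Nat.exists_eq_succ_of_ne_zero hpos
  have hne := Nat.find_min hex (hk ▸ k.lt_succ_self)
  obtain ⟨x, hx, hx0⟩ := (Submodule.ne_bot_iff _).1 hne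
  refine ⟨x, (Submodule.span_singleton_le_iff_mem y A).2 hyA (Submodule.smul_le_right hx), hx0, ?_⟩
  rw [Submodule.mem_torsionBySet_iff]
  intro a
  rw [hk, Nat.succ_eq_add_one, pow_succ', Submodule.mul_smul] at hspec
  rw [← Submodule.mem_bot R, ← hspec]
  exact Submodule.smul_mem_smul a.2 hx

/-- A module annihilated by the maximal ideal admits a linear map from its restriction of scalars
along a local endomorphism whose kernel contains no nonzero submodule. -/
theorem exists_restrict_hom_forall_ne_zero (φ : R →+* R) [IsLocalHom φ] (S : Type v)
    [AddCommGroup S] [Module R S] (hS : ∀ r ∈ maximalIdeal R, ∀ x : S, r • x = 0) :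
    ∃ g : Restrict φ S →ₗ[R] S, ∀ x : S, x ≠ 0 → ∃ s : R, g (Restrict.of φ S (s • x)) ≠ 0 := by
  have hS' : Module.IsTorsionBySet R S (maximalIdeal R) := fun b r => hS r r.2 b
  let : Module (ResidueField R) S := hS'.module
  have hres : ∀ (r : R) (x : S), residue R r • x = r • x := fun _ _ => rfl
  let ψ := ResidueField.map φ
  obtain ⟨l, hl⟩ : ∃ l : Restrict ψ (ResidueField R) →ₗ[ResidueField R] ResidueField R,
      l (Restrict.of ψ _ 1) ≠ 0 := by
    by_contra! hl
    exact one_ne_zero (α := ResidueField R) ((Module.forall_dual_apply_eq_zero_iff (ResidueField R)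
      (Restrict.of ψ (ResidueField R) 1)).1 hl)
  have hlsmul : ∀ (r : R) a, l (Restrict.of ψ _ (residue R (φ r) * a)) =
      residue R r * l (Restrict.of ψ _ a) := fun r a => l.map_smul (residue R r) (Restrict.of ψ _ a)
  let b := Module.Basis.ofVectorSpace (ResidueField R) S
  let l' : ResidueField R → ResidueField R := fun a => l (Restrict.of ψ _ a)
  have hl' : l' 0 = 0 := l.map_zero
  refine ⟨{ toFun := fun x => b.repr.symm ((b.repr ((Restrict.of φ S).symm x)).mapRange l' hl')
            map_add' := fun x y => ?_
            map_smul' := fun r x => ?_ }, fun x hx => ?_⟩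
  · rw [map_add, map_add, Finsupp.mapRange_add (hf := hl') (fun a c => l.map_add _ _), map_add]
  · have h1 : (Restrict.of φ S).symm (r • x) = residue R (φ r) • (Restrict.of φ S).symm x := rfl
    rw [h1, map_smul, RingHom.id_apply, ← hres, ← b.repr.symm.map_smul]
    refine congrArg b.repr.symm (Finsupp.ext fun j => ?_)
    simpa using hlsmul r _
  · obtain ⟨j, hj⟩ := Finsupp.ne_iff.1 ((map_ne_zero_iff b.repr b.repr.injective).2 hx)
    -- Scaling by `s` makes the `j`-th coordinate `1`, where `l` is nonzero.
    obtain ⟨s, hs⟩ := residue_surjective (b.repr x j)⁻¹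
    refine ⟨s, fun h0 => hl ?_⟩
    change b.repr.symm ((b.repr (s • x)).mapRange l' hl') = 0 at h0
    rw [LinearEquiv.map_eq_zero_iff] at h0
    have := DFunLike.congr_fun h0 j
    rw [← hres, hs, Finsupp.mapRange_apply, map_smul, Finsupp.smul_apply, smul_eq_mul,
      inv_mul_cancel₀ hj] at this
    exact this

/-- The socle map `g` extends to `h` on all of `N`. Its adjoint `N → Hom(ᵠR, N)` is nonzero on
nonzero socle elements, hence injective because every nonzero submodule meets the socle; injectivity
of `N` splits it. -/
theorem Module.Injective.isDirectSummand_homTwist [IsNoetherianRing R] (φ : R →+* R) [IsLocalHom φ]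
    (N : Type w) [AddCommGroup N] [Module R N] [IsArtinian R N] [Small.{w} R]
    [Module.Injective R N] : IsDirectSummand R N (HomTwist φ N) := by
  let S := Submodule.torsionBySet R N (maximalIdeal R : Set R)
  obtain ⟨g, hg⟩ := exists_restrict_hom_forall_ne_zero φ S fun r hr x =>
    Subtype.ext ((Submodule.mem_torsionBySet_iff _ _).1 x.2 ⟨r, hr⟩)
  obtain ⟨h, hh⟩ := Module.Injective.extension_property R N _ _ (Restrict.map φ S.subtype)
    S.subtype_injective (S.subtype ∘ₗ g)
  have hinj : Function.Injective (HomTwist.curry φ h) := by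
    rw [← LinearMap.ker_eq_bot]
    by_contra hne
    obtain ⟨x, hx, hx0, hxS⟩ := exists_ne_zero_mem_torsionBySet_maximalIdeal hne
    obtain ⟨s, hs⟩ := hg ⟨x, hxS⟩ fun h0 => hx0 (congrArg Subtype.val h0)
    apply hs
    apply Subtype.ext
    refine (LinearMap.congr_fun hh (Restrict.of φ S (s • ⟨x, hxS⟩))).symm.trans ?_
    change HomTwist.eval φ N (HomTwist.curry φ h x) s = 0
    rw [LinearMap.mem_ker.1 hx]
    rfl
  obtain ⟨q, hq⟩ := Module.Injective.extension_property R N _ _ (HomTwist.curry φ h) hinj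
    LinearMap.id
  exact isDirectSummand_iff_exists_retraction.2 ⟨_, q, LinearMap.congr_fun hq⟩

end Injective

theorem mainTheorem5 {R : Type u} [CommRing R] [IsLocalRing R] [IsNoetherianRing R]
    (φ : R →+* R) (hfin : φ.Finite) (hcon : IsContracting φ)
    (M : Type v) [AddCommGroup M] [Module R M] [IsNoetherian R M]
    (N : Type w) [AddCommGroup N] [Module R N] [IsArtinian R N] [Small.{w} R] :
    (Module.Free R M ↔ IsDirectSummand R M (TensorTwist φ M)) ∧
    (Module.Injective R N ↔ IsDirectSummand R N (HomTwist φ N)) := by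
  have := hcon.1
  refine ⟨⟨fun _ => Module.Free.isDirectSummand_tensorTwist φ M, fun h => ?_⟩,
    ⟨fun _ => Module.Injective.isDirectSummand_homTwist φ N, fun h => ?_⟩⟩
  · exact free_of_projectiveModulo_pow M fun k => hcon.pow_maximalIdeal_induction
      (fun _ _ hIJ hI => hI.mono hIJ) (fun _ hJ => (hJ.tensorTwist φ).of_isDirectSummand h)
      (projectiveModulo_maximalIdeal M) k
  · exact (baer_of_injectiveModulo_pow N fun k => hcon.pow_maximalIdeal_induction
      (fun _ _ hIJ hI => hI.mono hIJ) (fun _ hJ => (hJ.homTwist φ).of_isDirectSummand h)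
      (injectiveModulo_maximalIdeal N) k).injective
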